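/- Let $A$ be a complete unital normed algebra over $\mathbb R$ (for instance the algebra of real or complex $N\times N$ matrices with any submultiplicative norm) and let $H:[0,\infty)\to A$ be continuous. For a permutation $\sigma$ of $[n]=\{1,\dots,n\}$ and $t\ge 0$ put $$\Delta_{\sigma,t}^n=\{(t_{\sigma(1)},\dots,t_{\sigma(n)}) : 0\le t_1\le\dots\le t_n\le t\},\qquad X_\sigma(t)=\int_{\Delta_{\sigma,t}^n}H(u_1)\cdots H(u_n)\,du_1\cdots du_n ,$$ and let $X_n(t)=X_{\mathrm{id}}(t)$ be the integral over the standard simplex $\Delta^n_t=\Delta^n_{\mathrm{id},t}$, with $X_0(t)=1$. For $\mu=\sum_\sigma\mu_\sigma\,\sigma\in\mathbb Q[S_n]$ write $X_n(t)\cdot\mu=\sum_\sigma\mu_\sigma X_\sigma(t)$. Let $\mathrm{Desc}(\sigma)=\{i : 1\le i<n,\ \sigma(i)>\sigma(i+1)\}$ and, for $S\subseteq[n-1]$, $$D^{(n)}_{=S}=\sum_{\mathrm{Desc}(\sigma)=S}\sigma,\qquad D^{(n)}_{S}=\sum_{\mathrm{Desc}(\sigma)\subseteq S}\sigma .$$ The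 algebra of permutations is $\bigoplus_{n}\mathbb Q[S_n]$ with the product $\sigma*\beta=\sum\gamma$, for $\sigma\in S_n$ and $\beta\in S_m$, over all $\gamma\in S_{n+m}$ such that the sequence $\gamma(1),\dots,\gamma(n)$ is ordered as $\sigma(1),\dots,\sigma(n)$ and $\gamma(n+1),\dots,\gamma(n+m)$ is ordered as $\beta(1),\dots,\beta(m)$; the descent algebra $\mathcal D$ is its unital subalgebra generated by the identity permutations $1_n\in S_n$, $n\ge1$. Then: 1. For every $t\ge0$ the Dyson series $X(t)=\sum_{n\ge0}X_n(t)$ converges absolutely, and it solves $\dot X(t)=X(t)H(t)$, $X(0)=1$, on $[0,\infty)$ (with the one-sided derivative at $0$). 2. For every $n\ge1$ the two elements $$\sum_{S\subseteq[n-1]}\frac{(-1)^{|S|}}{|S|+1}\,D^{(n)}_S=\sum_{S\subseteq[n-1]}\frac{(-1)^{|S|}}{n}\binom{n-1}{|S|}^{-1}D^{(n)}_{=S}$$ of $\mathbb Q[S_n]$ are equal and belong to $\mathcal D$. 3. For the logarithm $\Omega(t)=\log X(t)=\sum_{k\ge1}\frac{(-1)^{k-1}}{k}(X(t)-1)^k$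 one has $$\Omega(t)=\sum_{n\ge1}X_n(t)\cdot\Big(\sum_{S\subseteq[n-1]}\frac{(-1)^{|S|}}{|S|+1}D^{(n)}_S\Big)=\sum_{n\ge1}X_n(t)\cdot\Big(\sum_{S\subseteq[n-1]}\frac{(-1)^{|S|}}{n}\binom{n-1}{|S|}^{-1}D^{(n)}_{=S}\Big)$$ in the following two senses. (a) Formally, for every $t\ge0$: with a central variable $\lambda$, the power series $\sum_{n\ge0}X_n(t)\lambda^n\in A[[\lambda]]$ has constant term $1$, its formal logarithm has constant term $0$, and for $n\ge1$ the coefficient of $\lambda^n$ in this logarithm is the $n$-th term of either series above. (b) Analytically, for every $t\ge0$ with $\int_0^t\|H(s)\|\,ds<\log 2$: the logarithm series and both series above converge in $A$ to the same element $\Omega(t)$, the latter two absolutely, and $\exp(\Omega(t))=X(t)$. -/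

import Mathlib

open Set MeasureTheory

noncomputable section

namespace ContinuousBCH

/-! ### Permutations, descents, and the descent algebra -/

/-- The rational vector space `ℚ[S_n]` with basis the permutations of `n` letters.
The letters `1, …, n` of the text are the elements `0, …, n - 1` of `Fin n`. -/
abbrev PermSpace (n : ℕ) : Type := Equiv.Perm (Fin n) →₀ ℚ

/-- The descent set `{i | 1 ≤ i < n, σ(i) > σ(i+1)}` of a permutation, as a subset of
`[n-1] = {1, …, n-1}`: the `i`-th letter (counted from one) is the element `i - 1` of `Fin n`. -/
def descentSet {n : ℕ} (σ : Equiv.Perm (Fin n)) : Finset ℕ :=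
  (Finset.Ico 1 n).filter fun i =>
    ∃ h : i < n, σ ⟨i, h⟩ < σ ⟨i - 1, lt_of_le_of_lt (Nat.sub_le i 1) h⟩

/-- The Solomon element `D_{=S}`: the sum of the permutations with descent set equal to `S`. -/
def solomonEq (n : ℕ) (S : Finset ℕ) : PermSpace n :=
  ∑ σ : Equiv.Perm (Fin n) with descentSet σ = S, Finsupp.single σ 1

/-- The Solomon element `D_S`: the sum of the permutations with descent set contained in `S`. -/
def solomon (n : ℕ) (S : Finset ℕ) : PermSpace n :=
  ∑ σ : Equiv.Perm (Fin n) with descentSet σ ⊆ S, Finsupp.single σ 1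

/-- `γ ∈ S_{n+m}` occurs in the product `σ ∗ β`: the first `n` values of `γ` standardize to `σ`
and the last `m` values standardize to `β`, that is, they are ordered in the same way. -/
def OccursInProduct {n m : ℕ} (σ : Equiv.Perm (Fin n)) (β : Equiv.Perm (Fin m))
    (γ : Equiv.Perm (Fin (n + m))) : Prop :=
  (∀ i j : Fin n, γ (Fin.castAdd m i) < γ (Fin.castAdd m j) ↔ σ i < σ j) ∧
  (∀ i j : Fin m, γ (Fin.natAdd n i) < γ (Fin.natAdd n j) ↔ β i < β j)

open scoped Classical in
/-- The product `ℚ[S_n] × ℚ[S_m] → ℚ[S_{n+m}]` of the algebra of permutations: the bilinear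
extension of `σ ∗ β = ∑ γ`, over all `γ` that standardize to `σ` and `β`. -/
def permMul {n m : ℕ} (a : PermSpace n) (b : PermSpace m) : PermSpace (n + m) :=
  ∑ σ : Equiv.Perm (Fin n), ∑ β : Equiv.Perm (Fin m),
    (a σ * b β) • ∑ γ : Equiv.Perm (Fin (n + m)) with OccursInProduct σ β γ, Finsupp.single γ 1

/-- `MemDescentAlgebra n a` says that `a ∈ ℚ[S_n]` belongs to the degree `n` component of the
descent algebra, the unital graded subalgebra of `⨁ ℚ[S_n]` generated by the identity permutations.
(For `n = 0` the identity permutation is the unit of the algebra. As the generators are homogeneous,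
the components of the generated subalgebra are the smallest family of subspaces that contains the
unit and the generators and is closed under the product.) -/
inductive MemDescentAlgebra : (n : ℕ) → PermSpace n → Prop
  | one (n : ℕ) : MemDescentAlgebra n (Finsupp.single 1 1)
  | add {n : ℕ} {a b : PermSpace n} :
      MemDescentAlgebra n a → MemDescentAlgebra n b → MemDescentAlgebra n (a + b)
  | smul {n : ℕ} (q : ℚ) {a : PermSpace n} :
      MemDescentAlgebra n a → MemDescentAlgebra n (q • a)
  | mul {n m : ℕ} {a : PermSpace n} {b : PermSpace m} :
      MemDescentAlgebra n a → MemDescentAlgebra m b → MemDescentAlgebra (n + m) (permMul a b)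

/-- `∑_{S ⊆ [n-1]} (-1)^{|S|} / (|S| + 1) · D_S`. -/
def bchElement (n : ℕ) : PermSpace n :=
  ∑ S ∈ (Finset.Ico 1 n).powerset, ((-1 : ℚ) ^ S.card / ((S.card : ℚ) + 1)) • solomon n S

/-- `∑_{S ⊆ [n-1]} (-1)^{|S|} / n · binom(n-1, |S|)⁻¹ · D_{=S}` (used for `n ≥ 1` only). -/
def bchElementEq (n : ℕ) : PermSpace n :=
  ∑ S ∈ (Finset.Ico 1 n).powerset,
    ((-1 : ℚ) ^ S.card / (n : ℚ) * (((n - 1).choose S.card : ℕ) : ℚ)⁻¹) • solomonEq n S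

/-! ### Simplices and iterated integrals -/

/-- The standard simplex `{(t_1, …, t_n) | 0 ≤ t_1 ≤ ⋯ ≤ t_n ≤ t}`. -/
def simplex (n : ℕ) (t : ℝ) : Set (Fin n → ℝ) :=
  {u | Monotone u ∧ ∀ i, 0 ≤ u i ∧ u i ≤ t}

/-- The simplex `{(t_{σ(1)}, …, t_{σ(n)}) | 0 ≤ t_1 ≤ ⋯ ≤ t_n ≤ t}`. -/
def permSimplex {n : ℕ} (σ : Equiv.Perm (Fin n)) (t : ℝ) : Set (Fin n → ℝ) :=
  (fun u : Fin n → ℝ => u ∘ σ) '' simplex n t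

variable {A : Type*} [NormedRing A] [NormedAlgebra ℝ A]

/-- `⟨P | H⟩ = ∫_P H(u_1) ⋯ H(u_n) du_1 ⋯ du_n`, with the product taken in this order. -/
def pairing {n : ℕ} (P : Set (Fin n → ℝ)) (H : ℝ → A) : A :=
  ∫ u in P, (List.ofFn fun i => H (u i)).prod

/-- The `n`-th term `X_n(t) = ⟨Δ_t^n | H⟩` of the Dyson series. -/
def dysonTerm (H : ℝ → A) (n : ℕ) (t : ℝ) : A := pairing (simplex n t) H

/-- The Dyson series `X(t) = ∑_{n ≥ 0} X_n(t)`. -/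
def dyson (H : ℝ → A) (t : ℝ) : A := ∑' n, dysonTerm H n t

/-- `X_n(t) · μ = ∑_σ μ_σ X_σ(t)`, the linear extension in `μ ∈ ℚ[S_n]` of
`X_n(t) · σ = X_σ(t) = ⟨Δ_{σ,t}^n | H⟩`. -/
def dysonAct (H : ℝ → A) {n : ℕ} (μ : PermSpace n) (t : ℝ) : A :=
  ∑ σ : Equiv.Perm (Fin n), ((μ σ : ℚ) : ℝ) • pairing (permSimplex σ t) H

/-! ### Logarithms -/

/-- The formal logarithm `∑_{k ≥ 1} (-1)^{k-1} / k · (f - 1)^k` of a power series `f` with constant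
coefficient `1`, in a central variable and with coefficients in a possibly non-commutative algebra.
Since `(f - 1)^k` then has order at least `k`, only `k ≤ n` contribute to the `n`-th coefficient. -/
def formalLog (f : PowerSeries A) : PowerSeries A :=
  PowerSeries.mk fun n =>
    ∑ k ∈ Finset.Icc 1 n, ((-1 : ℝ) ^ (k - 1) / (k : ℝ)) • PowerSeries.coeff n ((f - 1) ^ k)

/-- `y` is the sum `∑_{k ≥ 1} (-1)^{k-1} / k · (x - 1)^k` of the logarithm series at `x`. -/
def HasLog (x y : A) : Prop :=
  HasSum (fun k : ℕ => ((-1 : ℝ) ^ k / ((k : ℝ) + 1)) • (x - 1) ^ (k + 1)) y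

end ContinuousBCH

end

noncomputable section

namespace ContinuousBCH

/-! ### Sequences that ascend outside a set of positions -/

/-! The formula comes from expanding powers of `X - 1`. By Fubini, a product of `k + 1` simplex
integrals of total degree `n` is one integral over a product of simplices, which is the set of
points of the cube whose coordinates ascend except at the `k` block boundaries `S`. Apart from the
null set of points with equal coordinates, this set is the disjoint union of the permuted simplices
with descents in `S`, so its integral is `X_n · D_S` (`pairing_blockSet`, `pairing_mul_pairing`).
The coefficient of degree `n` in the power `k + 1` is therefore the sum of `X_n · D_S` over `|S| =
k` (`coeff_dyson_sub_one_pow`), and the logarithm weights it by `(-1)^k / (k + 1)`.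

Cutting a sequence at the last boundary also gives `D_S ∗ 1_j = D_{S ∪ {i}}`, so every `D_S` is a
product of identities. The second form of the coefficients sums the weights over all `S` containing
a given descent set, which is a Beta integral (`sum_powerset_alternating`).

For the analysis, `X_{n+1}(t) = ∫ X_n H` (`dysonTerm_succ`) bounds the terms by `I^n / n!` with `I =
∫ ‖H‖`, whence convergence and the differential equation. The norms in positive degree add up to at
most `exp I - 1`, which is below `1` when `I < log 2`; the double series of the logarithm is then
absolutely summable and may be summed by powers or by degree (`exists_hasSum_log_coeff`). That `exp`
inverts the logarithm follows by differentiating along `1 + s z` (`exp_eq_of_hasLog`). -/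

/-- The sequence `f` ascends at every position, counted from one, that does not lie in `S`. -/
def AscendsOff {α : Type*} [Preorder α] {n : ℕ} (S : Finset ℕ) (f : Fin n → α) : Prop :=
  ∀ (i : ℕ) (h : i + 1 < n), i + 1 ∉ S → f ⟨i, Nat.lt_of_succ_lt h⟩ ≤ f ⟨i + 1, h⟩

theorem ascendsOff_empty_iff {α : Type*} [Preorder α] {n : ℕ} {f : Fin n → α} :
    AscendsOff ∅ f ↔ Monotone f := by
  cases n with
  | zero => exact ⟨fun _ => Subsingleton.monotone f, fun _ i h => absurd h (Nat.not_lt_zero _)⟩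
  | succ n =>
    rw [Fin.monotone_iff_le_succ]
    refine ⟨fun h i => h i (by omega) (by simp), fun h i hi _ => h ⟨i, by omega⟩⟩

/-- As `S` lies below `i`, the only comparison across the cut is the one at position `i`, and that
one is exempt. This serves both the product of permutations and the product of integrals. -/
theorem ascendsOff_insert_iff {α : Type*} [Preorder α] {i j : ℕ} {S : Finset ℕ}
    (hS : S ⊆ Finset.Ico 1 i) {f : Fin (i + j) → α} :
    AscendsOff (insert i S) f ↔
      AscendsOff S (fun k => f (Fin.castAdd j k)) ∧ Monotone (fun k => f (Fin.natAdd i k)) := by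
  rw [← ascendsOff_empty_iff]
  constructor
  · intro h
    refine ⟨fun k hk hkS => h k (by omega) ?_, fun k hk _ => h (i + k) (by omega) ?_⟩
    · simp only [Finset.mem_insert, not_or]
      exact ⟨by omega, hkS⟩
    · simp only [Finset.mem_insert, not_or]
      refine ⟨by omega, fun hk' => ?_⟩
      have := Finset.mem_Ico.1 (hS hk')
      omega
  · rintro ⟨h₁, h₂⟩ k hk hkS
    simp only [Finset.mem_insert, not_or] at hkS
    rcases lt_or_gt_of_ne hkS.1 with hki | hki
    · exact h₁ k hki hkS.2
    · obtain ⟨l, rfl⟩ := Nat.exists_eq_add_of_le (Nat.lt_succ_iff.1 hki)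
      exact h₂ l (by omega) (by simp)

theorem AscendsOff.congr {α β : Type*} [LinearOrder α] [LinearOrder β] {n : ℕ} {S : Finset ℕ}
    {f : Fin n → α} {g : Fin n → β} (h : ∀ a b, f a < f b ↔ g a < g b) :
    AscendsOff S f ↔ AscendsOff S g := by
  unfold AscendsOff
  refine forall₃_congr fun i hi _ => ?_
  rw [← not_lt, ← not_lt, h]

theorem descentSet_subset_iff {n : ℕ} {σ : Equiv.Perm (Fin n)} {S : Finset ℕ} :
    descentSet σ ⊆ S ↔ AscendsOff S σ := by
  constructor
  · intro h i hi hiS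
    by_contra hlt
    refine hiS (h ?_)
    simp only [descentSet, Finset.mem_filter, Finset.mem_Ico]
    exact ⟨⟨by omega, hi⟩, hi, not_le.1 hlt⟩
  · intro h i hi
    simp only [descentSet, Finset.mem_filter, Finset.mem_Ico] at hi
    obtain ⟨⟨h1, -⟩, hn, hlt⟩ := hi
    by_contra hiS
    obtain ⟨k, rfl⟩ := Nat.exists_eq_add_of_le' h1
    exact absurd (h k hn hiS) (not_le.2 hlt)

theorem descentSet_subset_Ico {n : ℕ} (σ : Equiv.Perm (Fin n)) :
    descentSet σ ⊆ Finset.Ico 1 n := Finset.filter_subset _ _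

/-! ### Standardization -/

/-- `σ ∘ τ⁻¹` is an order automorphism of a finite chain, hence trivial. -/
theorem perm_eq_of_lt_iff {n : ℕ} {σ τ : Equiv.Perm (Fin n)}
    (h : ∀ a b, σ a < σ b ↔ τ a < τ b) : σ = τ := by
  have key : StrictMono (τ.symm.trans σ) := fun a b hab => by
    simpa [h] using hab
  have h1 := Subsingleton.elim (key.orderIsoOfSurjective _ (τ.symm.trans σ).surjective)
    (OrderIso.refl (Fin n))
  ext a
  have := DFunLike.congr_fun h1 (τ a)
  simpa using congrArg Fin.val this

theorem exists_perm_lt_iff {α : Type*} [LinearOrder α] {n : ℕ} {f : Fin n → α}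
    (hf : Function.Injective f) : ∃ σ : Equiv.Perm (Fin n), ∀ a b, σ a < σ b ↔ f a < f b := by
  have hs : StrictMono (f ∘ Tuple.sort f) :=
    (Tuple.monotone_sort f).strictMono_of_injective (hf.comp (Tuple.sort f).injective)
  refine ⟨(Tuple.sort f).symm, fun a b => ?_⟩
  rw [← hs.lt_iff_lt]
  simp

theorem perm_eq_one_of_monotone {n : ℕ} {σ : Equiv.Perm (Fin n)} (h : Monotone σ) : σ = 1 :=
  perm_eq_of_lt_iff fun _ _ => (h.strictMono_of_injective σ.injective).lt_iff_lt

/-! ### The descent algebra -/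

theorem solomon_apply (n : ℕ) (S : Finset ℕ) (σ : Equiv.Perm (Fin n)) :
    solomon n S σ = if descentSet σ ⊆ S then 1 else 0 := by
  simp [solomon, Finsupp.finsetSum_apply, Finsupp.single_apply, Finset.sum_ite_eq']

theorem solomonEq_apply (n : ℕ) (S : Finset ℕ) (σ : Equiv.Perm (Fin n)) :
    solomonEq n S σ = if descentSet σ = S then 1 else 0 := by
  simp [solomonEq, Finsupp.finsetSum_apply, Finsupp.single_apply, Finset.sum_ite_eq']

theorem solomon_empty (n : ℕ) : solomon n ∅ = Finsupp.single 1 1 := by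
  ext σ
  rw [solomon_apply, Finsupp.single_apply]
  refine if_congr ?_ rfl rfl
  rw [descentSet_subset_iff, ascendsOff_empty_iff]
  exact ⟨fun h => (perm_eq_one_of_monotone h).symm, fun h => h ▸ monotone_id⟩

/-- Standardizing the first `i` values of `γ` provides `σ`; only the relative order of the values
matters for descents. -/
theorem occursInProduct_iff {i j : ℕ} {S : Finset ℕ} (hS : S ⊆ Finset.Ico 1 i)
    (γ : Equiv.Perm (Fin (i + j))) :
    (∃ σ, descentSet σ ⊆ S ∧ OccursInProduct σ 1 γ) ↔ descentSet γ ⊆ insert i S := by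
  simp only [descentSet_subset_iff]
  rw [ascendsOff_insert_iff hS]
  constructor
  · rintro ⟨σ, hσ, h₁, h₂⟩
    have h₂' : StrictMono fun k => γ (Fin.natAdd i k) := fun a b hab => (h₂ a b).2 hab
    exact ⟨(AscendsOff.congr h₁).2 hσ, h₂'.monotone⟩
  · rintro ⟨h₁, h₂⟩
    obtain ⟨σ, hσ⟩ := exists_perm_lt_iff
      (γ.injective.comp (Fin.castAdd_injective i j))
    refine ⟨σ, (AscendsOff.congr hσ).2 h₁, fun a b => (hσ a b).symm, fun a b => ?_⟩
    exact (h₂.strictMono_of_injective (γ.injective.comp (Fin.natAdd_injective j i))).lt_iff_lt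

/-- A given `γ` determines the `σ` to which its first `i` values standardize, so no permutation is
counted twice. -/
theorem permMul_solomon_one {i j : ℕ} {S : Finset ℕ} (hS : S ⊆ Finset.Ico 1 i) :
    permMul (solomon i S) (Finsupp.single (1 : Equiv.Perm (Fin j)) 1) =
      solomon (i + j) (insert i S) := by
  classical
  ext γ
  have hone : ∀ σ : Equiv.Perm (Fin i), (∑ β : Equiv.Perm (Fin j),
      (solomon i S σ * (Finsupp.single (1 : Equiv.Perm (Fin j)) (1 : ℚ)) β) •
        ∑ γ : Equiv.Perm (Fin (i + j)) with OccursInProduct σ β γ,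
          Finsupp.single γ (1 : ℚ)) γ =
      if descentSet σ ⊆ S ∧ OccursInProduct σ 1 γ then 1 else 0 := by
    intro σ
    rw [Finset.sum_eq_single 1]
    · simp only [solomon_apply, Finsupp.smul_apply, Finsupp.finsetSum_apply,
        Finsupp.single_apply, Finset.sum_ite_eq', Finset.mem_filter, Finset.mem_univ, true_and,
        smul_eq_mul, if_true, mul_one]
      by_cases h : descentSet σ ⊆ S <;> simp [h]
    · intro β _ hβ
      simp [hβ.symm]
    · simp
  rw [permMul, Finsupp.finsetSum_apply, solomon_apply]
  simp only [solomon_apply] at hone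
  simp only [solomon_apply, hone]
  by_cases h : descentSet γ ⊆ insert i S
  · rw [if_pos h]
    obtain ⟨σ, hσ⟩ := (occursInProduct_iff hS γ).2 h
    rw [Finset.sum_eq_single σ, if_pos hσ]
    · intro τ _ hτ
      refine if_neg fun h' => hτ (perm_eq_of_lt_iff fun a b => ?_)
      rw [← h'.2.1, ← hσ.2.1]
    · simp
  · rw [if_neg h]
    refine Finset.sum_eq_zero fun σ _ => if_neg fun h' => h ?_
    exact (occursInProduct_iff hS γ).1 ⟨σ, h'⟩

theorem MemDescentAlgebra.zero (n : ℕ) : MemDescentAlgebra n 0 := by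
  simpa using MemDescentAlgebra.smul 0 (MemDescentAlgebra.one n)

theorem MemDescentAlgebra.sum {ι : Type*} {n : ℕ} (s : Finset ι) (f : ι → PermSpace n)
    (h : ∀ i ∈ s, MemDescentAlgebra n (f i)) : MemDescentAlgebra n (∑ i ∈ s, f i) := by
  classical
  induction s using Finset.induction_on with
  | empty => exact MemDescentAlgebra.zero n
  | insert a s ha ih =>
    rw [Finset.sum_insert ha]
    exact .add (h a (Finset.mem_insert_self a s))
      (ih fun i hi => h i (Finset.mem_insert_of_mem hi))

theorem memDescentAlgebra_solomon (n : ℕ) (S : Finset ℕ) (hS : S ⊆ Finset.Ico 1 n) :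
    MemDescentAlgebra n (solomon n S) := by
  induction n using Nat.strong_induction_on generalizing S with
  | _ n ih =>
    rcases S.eq_empty_or_nonempty with rfl | hne
    · rw [solomon_empty]
      exact .one n
    · have hmax := S.max'_mem hne
      set i := S.max' hne with hi
      have hin := Finset.mem_Ico.1 (hS hmax)
      -- The total is `i + j + 1`: the block after the largest boundary `i` has `j + 1` letters, and
      -- it is split off as an identity permutation.
      obtain ⟨j, rfl⟩ := Nat.exists_eq_add_of_lt hin.2
      have hS' : S.erase i ⊆ Finset.Ico 1 i := fun k hk => by
        have hk' := Finset.mem_erase.1 hk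
        refine Finset.mem_Ico.2 ⟨(Finset.mem_Ico.1 (hS hk'.2)).1, ?_⟩
        exact lt_of_le_of_ne (S.le_max' k hk'.2) hk'.1
      rw [← Finset.insert_erase hmax, add_assoc, ← permMul_solomon_one hS']
      exact .mul (ih i (by omega) _ hS') (.one _)

theorem memDescentAlgebra_bchElement (n : ℕ) : MemDescentAlgebra n (bchElement n) :=
  MemDescentAlgebra.sum _ _ fun S hS =>
    .smul _ (memDescentAlgebra_solomon n S (Finset.mem_powerset.1 hS))

/-! ### The two expressions for the coefficients -/

/-- Both sides equal `∫ x^d (1 - x)^|U|` over `[0, 1]`. The induction uses only `(1 - x)^(u+1) = (1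
- x)^u - x (1 - x)^u`, which is why `d` has to vary. -/
theorem sum_powerset_alternating {α : Type*} [DecidableEq α] (U : Finset α) (d : ℕ) :
    ∑ R ∈ U.powerset, (-1 : ℚ) ^ R.card / ((d + R.card : ℕ) + 1) =
      (d.factorial * U.card.factorial : ℚ) / (d + U.card + 1).factorial := by
  induction U using Finset.induction_on generalizing d with
  | empty =>
    have : (d.factorial : ℚ) ≠ 0 := by positivity
    simp [Nat.factorial_succ]
    field_simp
  | insert a U ha ih =>
    have h2 : ∑ R ∈ U.powerset, (-1 : ℚ) ^ (insert a R).card /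
        ((d + (insert a R).card : ℕ) + 1) =
        -∑ R ∈ U.powerset, (-1 : ℚ) ^ R.card / ((d + 1 + R.card : ℕ) + 1) := by
      rw [← Finset.sum_neg_distrib]
      refine Finset.sum_congr rfl fun R hR => ?_
      rw [Finset.card_insert_of_notMem fun h => ha (Finset.mem_powerset.1 hR h)]
      push_cast
      ring
    rw [Finset.sum_powerset_insert ha, h2, ih, ih, Finset.card_insert_of_notMem ha,
      show d + (U.card + 1) + 1 = (d + U.card + 1) + 1 by ring,
      show d + 1 + U.card + 1 = (d + U.card + 1) + 1 by ring,
      Nat.factorial_succ (d + U.card + 1), Nat.factorial_succ d, Nat.factorial_succ U.card]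
    have : ((d + U.card + 1).factorial : ℚ) ≠ 0 := by positivity
    push_cast
    field_simp
    ring

theorem bchElementEq_apply {n : ℕ} (σ : Equiv.Perm (Fin n)) :
    bchElementEq n σ = (-1 : ℚ) ^ (descentSet σ).card / n *
      (((n - 1).choose (descentSet σ).card : ℕ) : ℚ)⁻¹ := by
  simp only [bchElementEq, Finsupp.finsetSum_apply, Finsupp.smul_apply, solomonEq_apply,
    smul_eq_mul, mul_ite, mul_one, mul_zero]
  rw [Finset.sum_ite_eq, if_pos (Finset.mem_powerset.2 (descentSet_subset_Ico σ))]

/-- The permutation `σ` occurs in `D_S` exactly when `S` contains its descent set `T`. Writing `S =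
T ∪ R` with `R` disjoint from `T` leaves an alternating sum over `R`. -/
theorem bchElement_apply {n : ℕ} (hn : 1 ≤ n) (σ : Equiv.Perm (Fin n)) :
    bchElement n σ = (-1 : ℚ) ^ (descentSet σ).card / n *
      (((n - 1).choose (descentSet σ).card : ℕ) : ℚ)⁻¹ := by
  set T := descentSet σ with hT
  have hTn : T ⊆ Finset.Ico 1 n := descentSet_subset_Ico σ
  have hTc : T.card ≤ n - 1 := by simpa using Finset.card_le_card hTn
  simp only [bchElement, Finsupp.finsetSum_apply, Finsupp.smul_apply, solomon_apply,
    smul_eq_mul, mul_ite, mul_one, mul_zero, ← hT]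
  rw [← Finset.sum_filter]
  have h1 : ∑ S ∈ (Finset.Ico 1 n).powerset with T ⊆ S, (-1 : ℚ) ^ S.card / (S.card + 1) =
      ∑ R ∈ (Finset.Ico 1 n \ T).powerset,
        (-1 : ℚ) ^ T.card * ((-1 : ℚ) ^ R.card / ((T.card + R.card : ℕ) + 1)) := by
    refine Finset.sum_bij' (fun S _ => S \ T) (fun R _ => T ∪ R) ?_ ?_ ?_ ?_ ?_
    · intro S hS
      simp only [Finset.mem_filter, Finset.mem_powerset] at hS ⊢
      exact Finset.sdiff_subset_sdiff hS.1 le_rfl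
    · intro R hR
      simp only [Finset.mem_filter, Finset.mem_powerset] at hR ⊢
      exact ⟨Finset.union_subset hTn (hR.trans Finset.sdiff_subset), Finset.subset_union_left⟩
    · intro S hS
      exact Finset.union_sdiff_of_subset (Finset.mem_filter.1 hS).2
    · intro R hR
      refine Finset.union_sdiff_cancel_left ?_
      exact Finset.disjoint_sdiff.mono_right (Finset.mem_powerset.1 hR)
    · intro S hS
      have := Finset.card_sdiff_add_card_eq_card (Finset.mem_filter.1 hS).2
      rw [← this, pow_add]
      push_cast
      ring
  rw [h1, ← Finset.mul_sum, sum_powerset_alternating, Finset.card_sdiff_of_subset hTn,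
    Nat.card_Ico, Nat.cast_choose ℚ hTc]
  have h2 : T.card + (n - 1 - T.card) + 1 = n := by omega
  have h3 : (n.factorial : ℚ) = n * (n - 1).factorial := by
    exact_mod_cast (Nat.mul_factorial_pred (by omega)).symm
  rw [h2, h3]
  have hn' : (n : ℚ) ≠ 0 := by positivity
  have hf : ((n - 1).factorial : ℚ) ≠ 0 := by positivity
  field_simp

theorem bchElement_eq_bchElementEq {n : ℕ} (hn : 1 ≤ n) : bchElement n = bchElementEq n := by
  ext σ
  rw [bchElement_apply hn, bchElementEq_apply]

section

/-! ### Polytopes in the cube -/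

/-- The points of the cube `[0, t]^n` whose coordinates ascend outside `S`. -/
def blockSet (n : ℕ) (S : Finset ℕ) (t : ℝ) : Set (Fin n → ℝ) :=
  {u | AscendsOff S u ∧ ∀ i, 0 ≤ u i ∧ u i ≤ t}

theorem blockSet_empty (n : ℕ) (t : ℝ) : blockSet n ∅ t = simplex n t := by
  ext u
  simp only [blockSet, simplex, mem_ofPred_eq, ascendsOff_empty_iff]

theorem isCompact_blockSet (n : ℕ) (S : Finset ℕ) (t : ℝ) : IsCompact (blockSet n S t) := by
  refine (isCompact_Icc (a := fun _ : Fin n => (0 : ℝ)) (b := fun _ => t)).of_isClosed_subset ?_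
    fun u hu => ⟨fun i => (hu.2 i).1, fun i => (hu.2 i).2⟩
  simp only [blockSet, AscendsOff, ofPred_and, ofPred_forall]
  refine IsClosed.inter ?_ ?_
  · exact isClosed_iInter fun i => isClosed_iInter fun h => isClosed_iInter fun _ =>
      isClosed_le (continuous_apply _) (continuous_apply _)
  · exact isClosed_iInter fun i => (isClosed_le continuous_const (continuous_apply _)).inter
      (isClosed_le (continuous_apply _) continuous_const)

theorem isCompact_simplex (n : ℕ) (t : ℝ) : IsCompact (simplex n t) :=
  blockSet_empty n t ▸ isCompact_blockSet n ∅ t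

theorem isCompact_permSimplex {n : ℕ} (σ : Equiv.Perm (Fin n)) (t : ℝ) :
    IsCompact (permSimplex σ t) :=
  (isCompact_simplex n t).image (continuous_pi fun _ => continuous_apply _)

theorem blockSet_insert {i j : ℕ} {S : Finset ℕ} (hS : S ⊆ Finset.Ico 1 i) (t : ℝ) :
    blockSet (i + j) (insert i S) t =
      {u | (fun k => u (Fin.castAdd j k)) ∈ blockSet i S t ∧
        (fun k => u (Fin.natAdd i k)) ∈ simplex j t} := by
  ext u
  simp only [blockSet, simplex, mem_ofPred_eq, ascendsOff_insert_iff hS, Fin.forall_fin_add]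
  tauto

theorem simplex_succ (n : ℕ) (t : ℝ) :
    simplex (n + 1) t = {u | u (Fin.last n) ∈ Icc 0 t ∧
      (fun k => u (Fin.castSucc k)) ∈ simplex n (u (Fin.last n))} := by
  ext u
  simp only [simplex, mem_ofPred_eq, mem_Icc]
  constructor
  · rintro ⟨hm, hb⟩
    exact ⟨hb _, fun a b hab => hm (Fin.castSucc_le_castSucc_iff.2 hab),
      fun i => ⟨(hb _).1, hm (Fin.le_last _)⟩⟩
  · rintro ⟨hl, hm, hb⟩
    have hle : ∀ a, u a ≤ u (Fin.last n) := fun a => by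
      refine Fin.lastCases le_rfl (fun a => (hb a).2) a
    refine ⟨fun a b => ?_, fun i => ⟨?_, (hle i).trans hl.2⟩⟩
    · refine Fin.lastCases (fun _ => hle a) (fun b => ?_) b
      refine Fin.lastCases (fun h => ?_) (fun a h => hm (Fin.castSucc_le_castSucc_iff.1 h)) a
      exact absurd h (not_le.2 (Fin.castSucc_lt_last b))
    · exact Fin.lastCases hl.1 (fun a => (hb a).1) i

/-! ### The cube as a union of simplices -/

theorem measurableSet_injective (n : ℕ) :
    MeasurableSet {u : Fin n → ℝ | Function.Injective u} := by
  simp only [Function.Injective, ofPred_forall]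
  refine MeasurableSet.iInter fun a => MeasurableSet.iInter fun b => ?_
  by_cases hab : a = b
  · simp [hab]
  · simp only [hab, imp_false]
    exact (measurableSet_eq_fun (measurable_pi_apply a) (measurable_pi_apply b)).compl

/-- Each diagonal `u a = u b` with `a ≠ b` is a proper subspace, hence null. -/
theorem ae_injective (n : ℕ) : ∀ᵐ u : Fin n → ℝ, Function.Injective u := by
  simp only [Function.Injective]
  refine ae_all_iff.2 fun a => ae_all_iff.2 fun b => ?_
  by_cases hab : a = b
  · simp [hab]
  · simp only [hab, imp_false]
    let L : (Fin n → ℝ) →ₗ[ℝ] ℝ := LinearMap.proj (R := ℝ) (φ := fun _ => ℝ) a - LinearMap.proj (R := ℝ) (φ := fun _ => ℝ) b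
    have hL : LinearMap.ker L ≠ ⊤ := by
      intro h
      have : L (Pi.single a 1) = 0 := LinearMap.mem_ker.1 (h ▸ Submodule.mem_top)
      simp [L, Ne.symm hab] at this
    have := Measure.addHaar_submodule (volume : Measure (Fin n → ℝ)) _ hL
    rw [ae_iff]
    convert this using 2
    ext u
    simp [L, sub_eq_zero]

theorem inter_injective_ae_eq {n : ℕ} (P : Set (Fin n → ℝ)) :
    (P ∩ {u | Function.Injective u} : Set (Fin n → ℝ)) =ᵐ[volume] P :=
  inter_ae_eq_left_of_ae_eq_univ (Filter.eventuallyEq_univ.2 (ae_injective n))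

/-- Without ties, the weak inequalities that define the simplex become strict, so they fix the order
pattern of `u` completely. -/
theorem mem_permSimplex_iff {n : ℕ} {σ : Equiv.Perm (Fin n)} {t : ℝ} {u : Fin n → ℝ}
    (hu : Function.Injective u) :
    u ∈ permSimplex σ t ↔ (∀ a b, σ a < σ b ↔ u a < u b) ∧ ∀ i, 0 ≤ u i ∧ u i ≤ t := by
  constructor
  · rintro ⟨v, ⟨hv, hb⟩, rfl⟩
    have hv' : Function.Injective v := by
      have := hu.comp σ.symm.injective
      simpa [Function.comp_assoc] using this
    exact ⟨fun a b => (hv.strictMono_of_injective hv').lt_iff_lt.symm, fun i => hb _⟩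
  · rintro ⟨h, hb⟩
    refine ⟨u ∘ σ.symm, ⟨?_, fun i => hb _⟩, by ext; simp⟩
    have : StrictMono (u ∘ σ.symm) := fun a b hab => by
      simpa [← h] using hab
    exact this.monotone

theorem blockSet_inter_injective (n : ℕ) (S : Finset ℕ) (t : ℝ) :
    blockSet n S t ∩ {u | Function.Injective u} =
      ⋃ σ ∈ ({σ | descentSet σ ⊆ S} : Finset (Equiv.Perm (Fin n))),
        permSimplex σ t ∩ {u | Function.Injective u} := by
  ext u
  simp only [mem_iUnion, mem_inter_iff, Finset.mem_filter, Finset.mem_univ, true_and,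
    exists_prop, mem_ofPred_eq, descentSet_subset_iff]
  constructor
  · rintro ⟨⟨hu, hb⟩, hi⟩
    obtain ⟨σ, hσ⟩ := exists_perm_lt_iff hi
    exact ⟨σ, (AscendsOff.congr hσ).2 hu, (mem_permSimplex_iff hi).2 ⟨hσ, hb⟩, hi⟩
  · rintro ⟨σ, hS, hu, hi⟩
    obtain ⟨hσ, hb⟩ := (mem_permSimplex_iff hi).1 hu
    exact ⟨⟨(AscendsOff.congr hσ).1 hS, hb⟩, hi⟩

/-! ### Iterated integrals -/

theorem continuous_ofFn_prod {A : Type*} [NormedRing A] {H : ℝ → A} (hH : Continuous H) (n : ℕ) :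
    Continuous fun u : Fin n → ℝ => (List.ofFn fun i => H (u i)).prod := by
  simp only [List.ofFn_eq_map]
  exact continuous_list_prod _ fun i _ => hH.comp (continuous_apply i)

theorem integrableOn_ofFn_prod {A : Type*} [NormedRing A] {H : ℝ → A} (hH : Continuous H) {n : ℕ} {P : Set (Fin n → ℝ)}
    (hP : IsCompact P) : IntegrableOn (fun u => (List.ofFn fun i => H (u i)).prod) P :=
  (continuous_ofFn_prod hH n).continuousOn.integrableOn_compact hP

variable {A : Type*} [NormedRing A] [NormedAlgebra ℝ A]

theorem pairing_blockSet {H : ℝ → A} (hH : Continuous H) (n : ℕ) (S : Finset ℕ) (t : ℝ) :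
    pairing (blockSet n S t) H =
      ∑ σ : Equiv.Perm (Fin n) with descentSet σ ⊆ S, pairing (permSimplex σ t) H := by
  unfold pairing
  rw [← setIntegral_congr_set (inter_injective_ae_eq (blockSet n S t)),
    blockSet_inter_injective, integral_biUnion_finset]
  · exact Finset.sum_congr rfl fun σ _ =>
      setIntegral_congr_set (inter_injective_ae_eq (permSimplex σ t))
  · exact fun σ _ => (isCompact_permSimplex σ t).measurableSet.inter (measurableSet_injective n)
  · intro σ _ τ _ hne
    refine Set.disjoint_left.2 fun u hu hu' => hne (perm_eq_of_lt_iff fun a b => ?_)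
    rw [((mem_permSimplex_iff hu.2).1 hu.1).1, ((mem_permSimplex_iff hu.2).1 hu'.1).1]
  · exact fun σ _ => (integrableOn_ofFn_prod hH (isCompact_permSimplex σ t)).mono_set
      inter_subset_left

/-- Fubini on `ℝ^(i+j) = ℝ^i × ℝ^j`. The factors stay in their order, so no commutativity is
involved. -/
theorem pairing_mul_pairing {H : ℝ → A} (hH : Continuous H) {i j : ℕ}
    {P : Set (Fin i → ℝ)} {Q : Set (Fin j → ℝ)} (hP : IsCompact P) (hQ : IsCompact Q) :
    pairing P H * pairing Q H =
      pairing {u : Fin (i + j) → ℝ | (fun k => u (Fin.castAdd j k)) ∈ P ∧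
        (fun k => u (Fin.natAdd i k)) ∈ Q} H := by
  let e : (Fin (i + j) → ℝ) ≃ᵐ (Fin i → ℝ) × (Fin j → ℝ) :=
    (MeasurableEquiv.piCongrLeft (fun _ => ℝ) finSumFinEquiv).symm.trans
      (MeasurableEquiv.sumPiEquivProdPi fun _ => ℝ)
  have he : MeasurePreserving e volume volume :=
    (volume_measurePreserving_piCongrLeft (fun _ => ℝ) finSumFinEquiv).symm.trans
      (volume_measurePreserving_sumPiEquivProdPi fun _ => ℝ)
  let F : (Fin i → ℝ) × (Fin j → ℝ) → A := fun p =>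
    (List.ofFn fun k => H (p.1 k)).prod * (List.ofFn fun k => H (p.2 k)).prod
  have hF : ∀ u, (List.ofFn fun k => H (u k)).prod = F (e u) := fun u => by
    rw [List.ofFn_add, List.prod_append]
    rfl
  have hFc : Continuous F := ((continuous_ofFn_prod hH i).comp continuous_fst).mul
    ((continuous_ofFn_prod hH j).comp continuous_snd)
  have hset : {u : Fin (i + j) → ℝ | (fun k => u (Fin.castAdd j k)) ∈ P ∧
      (fun k => u (Fin.natAdd i k)) ∈ Q} = e ⁻¹' (P ×ˢ Q) := rfl
  rw [hset]
  simp only [pairing, hF]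
  rw [he.setIntegral_preimage_emb e.measurableEmbedding, Measure.volume_eq_prod,
    setIntegral_prod _ (hFc.continuousOn.integrableOn_compact (hP.prod hQ)),
    ← integral_mul_const_of_integrable (integrableOn_ofFn_prod hH hP)]
  exact integral_congr_ae (.of_forall fun p =>
    (integral_const_mul_of_integrable (integrableOn_ofFn_prod hH hQ)).symm)

theorem pairing_blockSet_mul_dysonTerm {H : ℝ → A} (hH : Continuous H) {i : ℕ} (j : ℕ)
    {S : Finset ℕ} (hS : S ⊆ Finset.Ico 1 i) (t : ℝ) :
    pairing (blockSet i S t) H * dysonTerm H j t =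
      pairing (blockSet (i + j) (insert i S) t) H := by
  rw [dysonTerm, pairing_mul_pairing hH (isCompact_blockSet _ _ _) (isCompact_simplex _ _),
    blockSet_insert hS]

theorem dysonTerm_zero [CompleteSpace A] (H : ℝ → A) (t : ℝ) : dysonTerm H 0 t = 1 := by
  have : simplex 0 t = univ := by
    ext u
    simp [simplex, Subsingleton.monotone]
  have hv : (volume : Measure (Fin 0 → ℝ)) = Measure.dirac 0 := Measure.volume_pi_eq_dirac _
  simp [dysonTerm, pairing, this, hv]

/-- Fubini after slicing the simplex by its last and largest coordinate `s`, whose factor `H s`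
stands on the right. -/
theorem dysonTerm_succ {H : ℝ → A} (hH : Continuous H) (n : ℕ) {t : ℝ} (ht : 0 ≤ t) :
    dysonTerm H (n + 1) t = ∫ s in 0..t, dysonTerm H n s * H s := by
  let e := MeasurableEquiv.piFinSuccAbove (fun _ : Fin (n + 1) => ℝ) (Fin.last n)
  have he : MeasurePreserving e volume volume :=
    volume_preserving_piFinSuccAbove (fun _ => ℝ) (Fin.last n)
  have heq : ∀ u, e u = (u (Fin.last n), fun k => u (Fin.castSucc k)) := fun u => by
    refine Prod.ext rfl (funext fun k => ?_)
    change u ((Fin.last n).succAbove k) = _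
    rw [Fin.succAbove_last]
  let F : ℝ × (Fin n → ℝ) → A := fun p => (List.ofFn fun k => H (p.2 k)).prod * H p.1
  let T : Set (ℝ × (Fin n → ℝ)) := {p | p.1 ∈ Icc 0 t ∧ p.2 ∈ simplex n p.1}
  have hset : simplex (n + 1) t = e ⁻¹' T := by
    rw [simplex_succ]
    ext u
    simp only [T, mem_preimage, heq, mem_ofPred_eq]
  have hF : ∀ u, (List.ofFn fun k => H (u k)).prod = F (e u) := fun u => by
    rw [List.ofFn_succ', List.concat_eq_append, List.prod_append, List.prod_singleton, heq]
  have hFc : Continuous F := ((continuous_ofFn_prod hH n).comp continuous_snd).mul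
    (hH.comp continuous_fst)
  -- Compactness supplies both the measurability and the integrability that Fubini needs.
  have hT : IsCompact T := by
    have : T = e '' simplex (n + 1) t := by
      rw [hset, image_preimage_eq _ e.surjective]
    rw [this]
    refine (isCompact_simplex _ _).image ?_
    have : ⇑e = fun u => (u (Fin.last n), fun k => u (Fin.castSucc k)) := funext heq
    rw [this]
    fun_prop
  have hFi : IntegrableOn F T := hFc.continuousOn.integrableOn_compact hT
  rw [dysonTerm, pairing, hset]
  simp only [hF]
  rw [he.setIntegral_preimage_emb e.measurableEmbedding, ← integral_indicator hT.measurableSet,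
    Measure.volume_eq_prod,
    integral_prod _ ((integrable_indicator_iff hT.measurableSet).2 hFi),
    intervalIntegral.integral_of_le ht, ← integral_Icc_eq_integral_Ioc,
    ← integral_indicator measurableSet_Icc]
  congr 1 with s
  by_cases hs : s ∈ Icc 0 t
  · rw [indicator_of_mem hs, dysonTerm, pairing,
      ← integral_mul_const_of_integrable (integrableOn_ofFn_prod hH (isCompact_simplex n s)),
      ← integral_indicator (isCompact_simplex n s).measurableSet]
    congr 1 with v
    by_cases hv : v ∈ simplex n s
    · rw [indicator_of_mem hv, indicator_of_mem (show (s, v) ∈ T from ⟨hs, hv⟩)]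
    · rw [indicator_of_notMem hv, indicator_of_notMem fun h => hv h.2]
  · rw [indicator_of_notMem hs]
    refine integral_eq_zero_of_ae (.of_forall fun v => ?_)
    exact indicator_of_notMem (fun h => hs h.1) _

/-! ### The action on the Dyson series -/

theorem dysonAct_sum_smul {ι : Type*} (H : ℝ → A) {n : ℕ} (s : Finset ι) (c : ι → ℚ)
    (μ : ι → PermSpace n) (t : ℝ) :
    dysonAct H (∑ i ∈ s, c i • μ i) t = ∑ i ∈ s, (c i : ℝ) • dysonAct H (μ i) t := by
  simp only [dysonAct, Finsupp.finsetSum_apply, Finsupp.smul_apply, Finset.smul_sum, smul_smul,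
    smul_eq_mul]
  rw [Finset.sum_comm]
  refine Finset.sum_congr rfl fun σ _ => ?_
  push_cast
  rw [Finset.sum_smul]

theorem dysonAct_solomon {H : ℝ → A} (hH : Continuous H) (n : ℕ) (S : Finset ℕ) (t : ℝ) :
    dysonAct H (solomon n S) t = pairing (blockSet n S t) H := by
  rw [pairing_blockSet hH, dysonAct, Finset.sum_filter]
  refine Finset.sum_congr rfl fun σ _ => ?_
  rw [solomon_apply]
  split_ifs <;> simp

theorem dysonAct_bchElement {H : ℝ → A} (hH : Continuous H) (n : ℕ) (t : ℝ) :
    dysonAct H (bchElement n) t = ∑ S ∈ (Finset.Ico 1 n).powerset,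
      ((-1 : ℝ) ^ S.card / ((S.card : ℝ) + 1)) • pairing (blockSet n S t) H := by
  rw [bchElement, dysonAct_sum_smul]
  refine Finset.sum_congr rfl fun S _ => ?_
  rw [dysonAct_solomon hH]
  push_cast
  rfl

end

/-! ### The formal logarithm of the Dyson series -/

/-- Sorting the sets by their largest element `i` matches the Cauchy product with one more factor `X
- 1`, where `i` is the degree of the preceding factors. -/
theorem sum_powersetCard_succ_Ico {M : Type*} [AddCommMonoid M] (F : Finset ℕ → M) (k n : ℕ) :
    ∑ S ∈ Finset.powersetCard (k + 1) (Finset.Ico 1 n), F S =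
      ∑ i ∈ Finset.Ico 1 n, ∑ R ∈ Finset.powersetCard k (Finset.Ico 1 i), F (insert i R) := by
  induction n with
  | zero => simp [Finset.powersetCard_eq_empty.2 (show (∅ : Finset ℕ).card < k + 1 from k.succ_pos)]
  | succ n ih =>
    rcases Nat.eq_zero_or_pos n with rfl | hn
    · simp [Finset.powersetCard_eq_empty.2 (show (∅ : Finset ℕ).card < k + 1 from k.succ_pos)]
    · have hmem : n ∉ Finset.Ico 1 n := by simp
      have hR : ∀ R ∈ Finset.powersetCard k (Finset.Ico 1 n), n ∉ R := fun R hR h =>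
        hmem ((Finset.mem_powersetCard.1 hR).1 h)
      rw [← Finset.insert_Ico_right_eq_Ico_add_one hn, Finset.sum_insert hmem, ← ih,
        Finset.powersetCard_succ_insert hmem, Finset.sum_union, Finset.sum_image, add_comm]
      · intro R₁ h₁ R₂ h₂ h
        rw [← Finset.erase_insert (hR R₁ h₁), ← Finset.erase_insert (hR R₂ h₂)]
        exact congrArg (fun T : Finset ℕ => T.erase n) h
      · refine Finset.disjoint_left.2 fun S hS hS' => ?_
        obtain ⟨R, -, rfl⟩ := Finset.mem_image.1 hS'
        exact hmem ((Finset.mem_powersetCard.1 hS).1 (Finset.mem_insert_self n R))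

theorem coeff_pow_eq_zero_of_lt {R : Type*} [Semiring R] {g : PowerSeries R}
    (hg : PowerSeries.coeff 0 g = 0) {n k : ℕ} (hnk : n < k) :
    PowerSeries.coeff n (g ^ k) = 0 := by
  induction k generalizing n with
  | zero => omega
  | succ k ih =>
    rw [pow_succ, PowerSeries.coeff_mul]
    refine Finset.sum_eq_zero fun p hp => ?_
    have hp' := Finset.HasAntidiagonal.mem_antidiagonal.1 hp
    rcases Nat.eq_zero_or_pos p.2 with h | h
    · rw [h, hg, mul_zero]
    · rw [ih (by omega), zero_mul]

section Formal

variable {A : Type*} [NormedRing A] [NormedAlgebra ℝ A]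

theorem coeff_zero_formalLog (f : PowerSeries A) : PowerSeries.coeff 0 (formalLog f) = 0 := by
  simp [formalLog]

theorem coeff_formalLog_eq_sum_range (f : PowerSeries A) (n : ℕ) :
    PowerSeries.coeff n (formalLog f) = ∑ k ∈ Finset.range n,
      ((-1 : ℝ) ^ k / ((k : ℝ) + 1)) • PowerSeries.coeff n ((f - 1) ^ (k + 1)) := by
  rw [formalLog, PowerSeries.coeff_mk, Finset.range_eq_Ico, ← Finset.Ico_add_one_right_eq_Icc,
    ← Finset.sum_Ico_add' _ 0 n 1]
  simp

variable [CompleteSpace A]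

theorem coeff_dyson_sub_one (H : ℝ → A) (t : ℝ) (n : ℕ) :
    PowerSeries.coeff n ((PowerSeries.mk fun n => dysonTerm H n t) - 1) =
      if n = 0 then 0 else dysonTerm H n t := by
  rw [map_sub, PowerSeries.coeff_mk, PowerSeries.coeff_one]
  split_ifs with h
  · rw [h, dysonTerm_zero, sub_self]
  · rw [sub_zero]

theorem coeff_dyson_sub_one_pow {H : ℝ → A} (hH : Continuous H) (t : ℝ) (k : ℕ) {n : ℕ}
    (hn : 1 ≤ n) :
    PowerSeries.coeff n (((PowerSeries.mk fun n => dysonTerm H n t) - 1) ^ (k + 1)) =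
      ∑ S ∈ Finset.powersetCard k (Finset.Ico 1 n), pairing (blockSet n S t) H := by
  induction k generalizing n with
  | zero =>
    rw [zero_add, pow_one, coeff_dyson_sub_one, if_neg (by omega)]
    simp [blockSet_empty, dysonTerm]
  | succ k ih =>
    rw [pow_succ, PowerSeries.coeff_mul, sum_powersetCard_succ_Ico,
      Finset.Nat.sum_antidiagonal_eq_sum_range_succ_mk]
    have hsub : Finset.Ico 1 n ⊆ Finset.range n.succ := fun i hi => by
      have := Finset.mem_Ico.1 hi
      exact Finset.mem_range.2 (by omega)
    rw [← Finset.sum_subset hsub]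
    · refine Finset.sum_congr rfl fun i hi => ?_
      obtain ⟨h1, hlt⟩ := Finset.mem_Ico.1 hi
      obtain ⟨j, rfl⟩ := Nat.exists_eq_add_of_le hlt.le
      dsimp only
      rw [ih h1, coeff_dyson_sub_one, if_neg (by omega), Finset.sum_mul, Nat.add_sub_cancel_left]
      exact Finset.sum_congr rfl fun S hS =>
        pairing_blockSet_mul_dysonTerm hH j (Finset.mem_powersetCard.1 hS).1 t
    -- The remaining indices are `i = 0` and `i = n`, where one factor is a vanishing constant
    -- coefficient.
    · intro i hi hi'
      simp only [Finset.mem_range, Finset.mem_Ico, not_and, not_lt] at hi hi'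
      dsimp only
      rcases Nat.eq_zero_or_pos i with rfl | hpos
      · rw [coeff_pow_eq_zero_of_lt (by rw [coeff_dyson_sub_one, if_pos rfl]) (Nat.succ_pos k),
          zero_mul]
      · rw [coeff_dyson_sub_one, if_pos (by have := hi' hpos; omega), mul_zero]

/-- Grouping the sets by cardinality `k` matches the power `k + 1` in the logarithm. -/
theorem coeff_formalLog_dyson {H : ℝ → A} (hH : Continuous H) (t : ℝ) {n : ℕ} (hn : 1 ≤ n) :
    PowerSeries.coeff n (formalLog (PowerSeries.mk fun n => dysonTerm H n t)) =
      dysonAct H (bchElement n) t := by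
  rw [dysonAct_bchElement hH, Finset.sum_powerset, Nat.card_Ico, Nat.sub_add_cancel hn,
    coeff_formalLog_eq_sum_range]
  refine Finset.sum_congr rfl fun k _ => ?_
  rw [coeff_dyson_sub_one_pow hH t k hn, Finset.smul_sum]
  refine Finset.sum_congr rfl fun S hS => ?_
  rw [(Finset.mem_powersetCard.1 hS).2]

/-! ### Convergence and the differential equation -/

theorem integral_pow_div_factorial {φ : ℝ → ℝ} (hφ : Continuous φ) (n : ℕ) (t : ℝ) :
    ∫ s in 0..t, (∫ r in 0..s, φ r) ^ n / n.factorial * φ s =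
      (∫ r in 0..t, φ r) ^ (n + 1) / (n + 1).factorial := by
  have hd : ∀ s, HasDerivAt (fun s => ∫ r in 0..s, φ r) (φ s) s := fun s =>
    (hφ.integral_hasStrictDerivAt 0 s).hasDerivAt
  have hc : Continuous fun s => ∫ r in 0..s, φ r :=
    continuous_iff_continuousAt.2 fun s => (hd s).continuousAt
  rw [intervalIntegral.integral_eq_sub_of_hasDerivAt
    (f := fun s => (∫ r in 0..s, φ r) ^ (n + 1) / (n + 1).factorial)]
  · simp
  · intro s _
    refine (((hd s).pow (n + 1)).div_const _).congr_deriv ?_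
    have : (n.factorial : ℝ) ≠ 0 := by positivity
    rw [Nat.factorial_succ]
    push_cast
    field_simp
  · exact Continuous.intervalIntegrable (by fun_prop) _ _

theorem continuousOn_dysonTerm {H : ℝ → A} (hH : Continuous H) (n : ℕ) :
    ContinuousOn (dysonTerm H n) (Ici 0) := by
  induction n with
  | zero => exact continuousOn_const.congr fun t _ => dysonTerm_zero H t
  | succ n ih =>
    -- Freezing the term at its value in `0` for negative times makes the integrand continuous on
    -- the whole line, without changing it on `[0, t]`.
    have hY : Continuous fun s => dysonTerm H n (max 0 s) * H s :=
      (ih.comp_continuous (by fun_prop) fun s => le_max_left 0 s).mul hH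
    have hI := intervalIntegral.continuous_primitive (μ := volume) (fun a b => hY.intervalIntegrable a b) 0
    refine hI.continuousOn.congr fun t ht => ?_
    rw [dysonTerm_succ hH n ht]
    refine intervalIntegral.integral_congr fun s hs => ?_
    rw [uIcc_of_le ht] at hs
    simp only [max_eq_right hs.1]

theorem norm_dysonTerm_succ_le {H : ℝ → A} (hH : Continuous H) (n : ℕ) {t : ℝ} (ht : 0 ≤ t) :
    ‖dysonTerm H (n + 1) t‖ ≤ (∫ s in 0..t, ‖H s‖) ^ (n + 1) / (n + 1).factorial := by
  induction n generalizing t with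
  | zero =>
    rw [dysonTerm_succ hH 0 ht]
    simpa [dysonTerm_zero] using
      intervalIntegral.norm_integral_le_integral_norm (f := H) (μ := volume) ht
  | succ n ih =>
    rw [dysonTerm_succ hH _ ht, ← integral_pow_div_factorial hH.norm]
    have hc : Continuous fun s => ∫ r in 0..s, ‖H r‖ :=
      intervalIntegral.continuous_primitive (μ := volume) (fun a b => hH.norm.intervalIntegrable a b) 0
    refine intervalIntegral.norm_integral_le_of_norm_le ht (.of_forall fun s hs => ?_)
      (Continuous.intervalIntegrable (by fun_prop) _ _)
    exact (norm_mul_le _ _).trans (mul_le_mul_of_nonneg_right (ih hs.1.le) (norm_nonneg _))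

/-- A bound uniform in `s ≤ t`, for dominated convergence. The norm of `1` is not assumed to be `1`:
the factor `‖1‖ + 1` covers degree zero and is at least `1` for the other degrees. -/
theorem norm_dysonTerm_le {H : ℝ → A} (hH : Continuous H) (n : ℕ) {s t : ℝ} (hs : 0 ≤ s)
    (hst : s ≤ t) :
    ‖dysonTerm H n s‖ ≤ (‖(1 : A)‖ + 1) * ((∫ r in 0..t, ‖H r‖) ^ n / n.factorial) := by
  cases n with
  | zero => simp [dysonTerm_zero]
  | succ n =>
    have h0 : 0 ≤ ∫ r in 0..s, ‖H r‖ :=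
      intervalIntegral.integral_nonneg hs fun _ _ => norm_nonneg _
    have hle : (∫ r in 0..s, ‖H r‖) ≤ ∫ r in 0..t, ‖H r‖ :=
      intervalIntegral.integral_mono_interval le_rfl hs hst (.of_forall fun _ => norm_nonneg _)
        (hH.norm.intervalIntegrable _ _)
    have h1 : (∫ r in 0..s, ‖H r‖) ^ (n + 1) / (n + 1).factorial ≤
        (∫ r in 0..t, ‖H r‖) ^ (n + 1) / (n + 1).factorial := by gcongr
    refine (norm_dysonTerm_succ_le hH n hs).trans (h1.trans ?_)
    refine le_mul_of_one_le_left ((by positivity : (0 : ℝ) ≤ _).trans h1) ?_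
    linarith [norm_nonneg (1 : A)]

theorem summable_norm_dysonTerm {H : ℝ → A} (hH : Continuous H) {t : ℝ} (ht : 0 ≤ t) :
    Summable fun n => ‖dysonTerm H n t‖ :=
  .of_nonneg_of_le (fun _ => norm_nonneg _) (fun n => norm_dysonTerm_le hH n ht le_rfl)
    ((Real.summable_pow_div_factorial _).mul_left _)

theorem continuous_dyson_max {H : ℝ → A} (hH : Continuous H) :
    Continuous fun s => dyson H (max 0 s) := by
  have hT : ∀ T, ContinuousOn (dyson H) (Icc 0 T) := fun T =>
    continuousOn_tsum (fun n => (continuousOn_dysonTerm hH n).mono fun _ hs => hs.1)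
      ((Real.summable_pow_div_factorial _).mul_left _)
      fun n s hs => norm_dysonTerm_le hH n hs.1 hs.2
  have : ContinuousOn (dyson H) (Ici 0) := fun s hs =>
    (hT (s + 1) s ⟨hs, by linarith⟩).mono_of_mem_nhdsWithin <| Filter.inter_mem
      self_mem_nhdsWithin (mem_nhdsWithin_of_mem_nhds (Iic_mem_nhds (by linarith)))
  exact this.comp_continuous (by fun_prop) fun s => le_max_left 0 s

theorem dyson_eq_one_add_integral {H : ℝ → A} (hH : Continuous H) {t : ℝ} (ht : 0 ≤ t) :
    dyson H t = 1 + ∫ s in 0..t, dyson H (max 0 s) * H s := by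
  have hu : uIoc 0 t ⊆ Icc 0 t := by
    rw [uIoc_of_le ht]
    exact Ioc_subset_Icc_self
  have hb := (Real.summable_pow_div_factorial (∫ r in 0..t, ‖H r‖)).mul_left (‖(1 : A)‖ + 1)
  have key : HasSum (fun n => ∫ s in 0..t, dysonTerm H n s * H s)
      (∫ s in 0..t, dyson H (max 0 s) * H s) := by
    refine intervalIntegral.hasSum_integral_of_dominated_convergence
      (fun n s => (‖(1 : A)‖ + 1) * ((∫ r in 0..t, ‖H r‖) ^ n / n.factorial) * ‖H s‖)
      (fun n => ?_) (fun n => ?_) ?_ ?_ ?_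
    · exact (((continuousOn_dysonTerm hH n).mono fun s hs => (hu hs).1).mul
        hH.continuousOn).aestronglyMeasurable measurableSet_uIoc
    · refine .of_forall fun s hs => (norm_mul_le _ _).trans ?_
      exact mul_le_mul_of_nonneg_right (norm_dysonTerm_le hH n (hu hs).1 (hu hs).2)
        (norm_nonneg _)
    · exact .of_forall fun s _ => hb.mul_right _
    · simp only [tsum_mul_right]
      exact (hH.norm.const_mul _).intervalIntegrable _ _
    · refine .of_forall fun s hs => ?_
      rw [max_eq_right (hu hs).1]
      exact (summable_norm_dysonTerm hH (hu hs).1).of_norm.hasSum.mul_right _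
  rw [dyson, (summable_norm_dysonTerm hH ht).of_norm.tsum_eq_zero_add, dysonTerm_zero,
    ← key.tsum_eq]
  exact congrArg _ (tsum_congr fun n => dysonTerm_succ hH n ht)

theorem dyson_zero {H : ℝ → A} (hH : Continuous H) : dyson H 0 = 1 := by
  rw [dyson_eq_one_add_integral hH le_rfl, intervalIntegral.integral_same, add_zero]

theorem hasDerivWithinAt_dyson {H : ℝ → A} (hH : Continuous H) {t : ℝ} (ht : 0 ≤ t) :
    HasDerivWithinAt (dyson H) (dyson H t * H t) (Ici 0) t := by
  have hc : Continuous fun s => dyson H (max 0 s) * H s := (continuous_dyson_max hH).mul hH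
  have := hc.integral_hasStrictDerivAt 0 t
  have h1 := (this.hasDerivAt.const_add (1 : A)).hasDerivWithinAt (s := Ici 0)
  simp only [max_eq_right ht] at h1
  exact h1.congr (fun s hs => dyson_eq_one_add_integral hH hs) (dyson_eq_one_add_integral hH ht)

end Formal

section

/-! ### Convergence of the logarithm series -/

theorem tsum_norm_antidiagonal_le {R : Type*} [NormedRing R] {a b : ℕ → R}
    (ha : Summable fun n => ‖a n‖) (hb : Summable fun n => ‖b n‖) :
    ∑' n, ‖∑ p ∈ Finset.HasAntidiagonal.antidiagonal n, a p.1 * b p.2‖ ≤ (∑' n, ‖a n‖) * ∑' n, ‖b n‖ := by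
  have ha' : Summable fun n => ‖‖a n‖‖ := by simpa using ha
  have hb' : Summable fun n => ‖‖b n‖‖ := by simpa using hb
  rw [tsum_mul_tsum_eq_tsum_sum_antidiagonal_of_summable_norm ha' hb']
  refine (summable_norm_sum_mul_antidiagonal_of_summable_norm ha hb).tsum_le_tsum
    (fun n => (norm_sum_le _ _).trans (Finset.sum_le_sum fun p _ => norm_mul_le _ _)) ?_
  exact (summable_norm_sum_mul_antidiagonal_of_summable_norm ha' hb').of_norm

theorem summable_norm_coeff_pow {R : Type*} [NormedRing R] [CompleteSpace R] {g : PowerSeries R}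
    (hg : Summable fun n => ‖PowerSeries.coeff n g‖) (k : ℕ) :
    (Summable fun n => ‖PowerSeries.coeff n (g ^ (k + 1))‖) ∧
      ∑' n, ‖PowerSeries.coeff n (g ^ (k + 1))‖ ≤
        (∑' n, ‖PowerSeries.coeff n g‖) ^ (k + 1) ∧
      ∑' n, PowerSeries.coeff n (g ^ (k + 1)) = (∑' n, PowerSeries.coeff n g) ^ (k + 1) := by
  induction k with
  | zero =>
    rw [zero_add]
    simp only [pow_one]
    exact ⟨hg, le_rfl, trivial⟩
  | succ k ih =>
    obtain ⟨h1, h2, h3⟩ := ih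
    have hmul : ∀ n, PowerSeries.coeff n (g ^ (k + 1 + 1)) =
        ∑ p ∈ Finset.HasAntidiagonal.antidiagonal n,
          PowerSeries.coeff p.1 (g ^ (k + 1)) * PowerSeries.coeff p.2 g := fun n => by
      rw [pow_succ g, PowerSeries.coeff_mul]
    have h4 := summable_norm_sum_mul_antidiagonal_of_summable_norm h1 hg
    have h5 := tsum_norm_antidiagonal_le h1 hg
    have h6 := tsum_mul_tsum_eq_tsum_sum_antidiagonal_of_summable_norm h1 hg
    simp only [← hmul] at h4 h5 h6
    refine ⟨h4, ?_, ?_⟩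
    · rw [pow_succ _ (k + 1)]
      exact h5.trans (mul_le_mul_of_nonneg_right h2 (tsum_nonneg fun _ => norm_nonneg _))
    · rw [← h6, h3, ← pow_succ]

theorem norm_neg_one_pow_div_le (k : ℕ) : ‖(-1 : ℝ) ^ k / ((k : ℝ) + 1)‖ ≤ 1 := by
  rw [norm_div, norm_pow, norm_neg, norm_one, one_pow, Real.norm_eq_abs,
    abs_of_pos (by positivity)]
  exact (div_le_one (by positivity)).2 (by linarith [(Nat.cast_nonneg k : (0 : ℝ) ≤ k)])

variable {A : Type*} [NormedRing A] [NormedAlgebra ℝ A] [CompleteSpace A]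

/-- The double series over the power `k + 1` and the degree `n` is dominated by a geometric series
in `k`. Summed over `n` first it is the logarithm series, summed over `k` first it is `∑ c n`. -/
theorem exists_hasSum_log_coeff {g : PowerSeries A}
    (hg : Summable fun n => ‖PowerSeries.coeff n g‖) (hg1 : ∑' n, ‖PowerSeries.coeff n g‖ < 1)
    (c : ℕ → A)
    (hc : ∀ n, HasSum (fun k : ℕ => ((-1 : ℝ) ^ k / ((k : ℝ) + 1)) •
      PowerSeries.coeff n (g ^ (k + 1))) (c n)) :
    ∃ Ω : A, HasLog (1 + ∑' n, PowerSeries.coeff n g) Ω ∧ (Summable fun n => ‖c n‖) ∧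
      HasSum c Ω := by
  set r := ∑' n, ‖PowerSeries.coeff n g‖ with hr
  have hr0 : 0 ≤ r := tsum_nonneg fun _ => norm_nonneg _
  let a : ℕ × ℕ → A := fun p =>
    ((-1 : ℝ) ^ p.1 / ((p.1 : ℝ) + 1)) • PowerSeries.coeff p.2 (g ^ (p.1 + 1))
  have hle : ∀ p : ℕ × ℕ, ‖a p‖ ≤ ‖PowerSeries.coeff p.2 (g ^ (p.1 + 1))‖ := fun p => by
    rw [norm_smul]
    exact mul_le_of_le_one_left (norm_nonneg _) (norm_neg_one_pow_div_le p.1)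
  have ha : Summable fun p => ‖a p‖ := by
    refine .of_nonneg_of_le (fun _ => norm_nonneg _) hle ?_
    refine (summable_prod_of_nonneg fun p => norm_nonneg _).2
      ⟨fun k => (summable_norm_coeff_pow hg k).1, ?_⟩
    refine .of_nonneg_of_le (fun k => tsum_nonneg fun _ => norm_nonneg _)
      (fun k => (summable_norm_coeff_pow hg k).2.1) ?_
    exact (summable_nat_add_iff 1).2 (summable_geometric_of_lt_one hr0 hg1)
  have ha' : Summable fun p : ℕ × ℕ => ‖a p.swap‖ := (Equiv.prodComm ℕ ℕ).summable_iff.2 ha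
  refine ⟨∑' p, a p, ?_, ?_, ?_⟩
  · refine ha.of_norm.hasSum.prod_fiberwise fun k => ?_
    rw [add_sub_cancel_left, ← (summable_norm_coeff_pow hg k).2.2]
    exact (summable_norm_coeff_pow hg k).1.of_norm.hasSum.const_smul _
  · refine .of_nonneg_of_le (fun _ => norm_nonneg _) (fun n => ?_) ha'.prod
    rw [← (hc n).tsum_eq]
    exact norm_tsum_le_tsum_norm (ha'.prod_factor n)
  · have := (Equiv.prodComm ℕ ℕ).hasSum_iff.2 ha.of_norm.hasSum
    exact this.prod_fiberwise hc

/-! ### The exponential of the logarithm -/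

/-- Commutativity gives `exp (G u) = exp (G s) * exp (G u - G s)`, so the derivative of `exp` at `0`
suffices. -/
theorem hasDerivAt_exp_of_commute {G : ℝ → A} {D : A} {s : ℝ} (hG : HasDerivAt G D s)
    (hc : ∀ u v, Commute (G u) (G v)) :
    HasDerivAt (fun u => NormedSpace.exp (G u)) (NormedSpace.exp (G s) * D) s := by
  let _ : NormedAlgebra ℚ A := NormedAlgebra.restrictScalars ℚ ℝ A
  have h0 : HasFDerivAt NormedSpace.exp (1 : A →L[ℝ] A) (G s - G s) := by
    rw [sub_self]
    exact hasFDerivAt_exp_zero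
  have h1 : HasDerivAt (NormedSpace.exp ∘ fun u => G u - G s) ((1 : A →L[ℝ] A) D) s :=
    h0.comp_hasDerivAt s (hG.sub_const (G s))
  refine (h1.const_mul (NormedSpace.exp (G s))).congr_of_eventuallyEq (.of_forall fun u => ?_)
  change NormedSpace.exp (G u) = NormedSpace.exp (G s) * NormedSpace.exp (G u - G s)
  rw [← NormedSpace.exp_add_of_commute ((hc s u).sub_right (Commute.refl _)), add_sub_cancel]

theorem exp_eq_of_hasLog {x Ω : A} (hx : ‖x - 1‖ < 1) (h : HasLog x Ω) :
    NormedSpace.exp Ω = x := by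
  let _ : NormedAlgebra ℚ A := NormedAlgebra.restrictScalars ℚ ℝ A
  set z := x - 1 with hz
  -- A radius `R > 1` makes the endpoint `s = 1` interior to the region of termwise differentiation.
  obtain ⟨R, hR1, hRz⟩ : ∃ R : ℝ, 1 < R ∧ R * ‖z‖ < 1 := by
    have hpos : 0 < 1 + ‖z‖ := by positivity
    refine ⟨2 / (1 + ‖z‖), (one_lt_div hpos).2 (by linarith), ?_⟩
    rw [div_mul_eq_mul_div, div_lt_one hpos]
    linarith
  let g : ℕ → ℝ → A := fun k s => ((-1 : ℝ) ^ k / ((k : ℝ) + 1) * s ^ (k + 1)) • z ^ (k + 1)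
  let g' : ℕ → ℝ → A := fun k s => ((-1 : ℝ) ^ k * s ^ k) • z ^ (k + 1)
  let G : ℝ → A := fun s => ∑' k, g k s
  let D : ℝ → A := fun s => ∑' k, g' k s
  have hg : ∀ k s, HasDerivAt (g k) (g' k s) s := fun k s => by
    have h1 := ((hasDerivAt_pow (k + 1) s).const_mul ((-1 : ℝ) ^ k / ((k : ℝ) + 1))).smul_const
      (z ^ (k + 1))
    refine h1.congr_deriv ?_
    simp only [g']
    congr 1
    push_cast
    field_simp
  have hg' : ∀ k, ∀ s ∈ Metric.ball (0 : ℝ) R, ‖g' k s‖ ≤ ‖z‖ * (R * ‖z‖) ^ k := by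
    intro k s hs
    have hs' : |s| ≤ R := by simpa using (Metric.mem_ball.1 hs).le
    rw [norm_smul, norm_mul, norm_pow, norm_neg, norm_one, one_pow, one_mul, norm_pow,
      Real.norm_eq_abs, mul_pow, mul_left_comm, ← pow_succ']
    exact mul_le_mul (pow_le_pow_left₀ (abs_nonneg s) hs' k) (norm_pow_le' z k.succ_pos)
      (norm_nonneg _) (by positivity)
  have hsum : Summable fun k => ‖z‖ * (R * ‖z‖) ^ k :=
    (summable_geometric_of_lt_one (by positivity) hRz).mul_left _
  have hG : ∀ s ∈ Metric.ball (0 : ℝ) R, HasDerivAt G (D s) s := fun s hs =>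
    hasDerivAt_tsum_of_isPreconnected hsum Metric.isOpen_ball
      (convex_ball (0 : ℝ) R).isPreconnected (fun k s _ => hg k s) hg'
      (Metric.mem_ball_self (by linarith)) (y₀ := 0) (by simp [g, summable_zero]) hs
  have hcomm : ∀ u v, Commute (G u) (G v) := fun u v =>
    Commute.tsum_right _ fun k => (Commute.tsum_right _ fun l =>
      ((Commute.refl z).pow_pow _ _).smul_left _ |>.smul_right _).symm
  -- Geometric series: `D s = z (1 + s z)⁻¹`, the derivative of `log (1 + s z)`.
  have hD : ∀ s ∈ Metric.ball (0 : ℝ) R, D s * (1 + s • z) = z := by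
    intro s hs
    have hs' : |s| < R := by simpa using Metric.mem_ball.1 hs
    have hlt : ‖-(s • z)‖ < 1 := by
      rw [norm_neg, norm_smul, Real.norm_eq_abs]
      exact (mul_le_mul_of_nonneg_right hs'.le (norm_nonneg _)).trans_lt hRz
    have hDs : D s = z * ∑' k, (-(s • z)) ^ k := by
      rw [← (summable_geometric_of_norm_lt_one hlt).tsum_mul_left]
      refine tsum_congr fun k => ?_
      simp only [g']
      rw [← neg_smul, smul_pow, mul_smul_comm, ← pow_succ', neg_pow s]
    rw [hDs, mul_assoc, ← sub_neg_eq_add, geom_series_mul_neg _ hlt, mul_one]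
  -- By `hD` the two terms of the product rule cancel, so `P` is constant; comparing `s = 0` with `s
  -- = 1` gives `exp (-Ω) * x = 1`.
  let P : ℝ → A := fun s => NormedSpace.exp (-G s) * (1 + s • z)
  have hP : ∀ s ∈ Metric.ball (0 : ℝ) R, HasDerivAt P 0 s := by
    intro s hs
    have h1 := hasDerivAt_exp_of_commute (hG s hs).neg fun u v =>
      ((hcomm u v).neg_left).neg_right
    have h2 : HasDerivAt (fun s : ℝ => 1 + s • z) z s := by
      simpa using ((hasDerivAt_id s).smul_const z).const_add 1
    refine (h1.mul h2).congr_deriv ?_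
    have := hD s hs
    simp only [Pi.neg_apply, mul_neg, neg_mul, mul_assoc, this]
    simp
  have hball : Icc (0 : ℝ) 1 ⊆ Metric.ball 0 R := fun s hs => by
    rw [Metric.mem_ball, dist_zero_right, Real.norm_eq_abs, abs_of_nonneg hs.1]
    exact hs.2.trans_lt hR1
  have hconst := constant_of_has_deriv_right_zero
    (fun s hs => (hP s (hball hs)).continuousAt.continuousWithinAt)
    (fun s hs => (hP s (hball (Ico_subset_Icc_self hs))).hasDerivWithinAt) 1
    (right_mem_Icc.2 zero_le_one)
  have hG0 : G 0 = 0 := by simp [G, g]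
  have hG1 : G 1 = Ω := by
    rw [← h.tsum_eq]
    simp [G, g, hz]
  have hfin : NormedSpace.exp (-Ω) * x = 1 := by
    simpa [P, hG0, hG1, hz] using hconst
  have hinv : NormedSpace.exp Ω * NormedSpace.exp (-Ω) = 1 := by
    rw [← NormedSpace.exp_add_of_commute (Commute.refl Ω).neg_right, add_neg_cancel,
      NormedSpace.exp_zero]
  calc NormedSpace.exp Ω = NormedSpace.exp Ω * (NormedSpace.exp (-Ω) * x) := by
        rw [hfin, mul_one]
    _ = x := by rw [← mul_assoc, hinv, one_mul]

end

/-! ### The logarithm of the Dyson series -/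

section Analytic

variable {A : Type*} [NormedRing A] [NormedAlgebra ℝ A] [CompleteSpace A]

theorem hasSum_pow_succ_div_factorial (x : ℝ) :
    HasSum (fun n : ℕ => x ^ (n + 1) / (n + 1).factorial) (Real.exp x - 1) := by
  have h := NormedSpace.expSeries_div_hasSum_exp x
  rw [← Real.exp_eq_exp_ℝ] at h
  simpa using (hasSum_nat_add_iff' 1).2 h

theorem exists_log_dyson {H : ℝ → A} (hH : Continuous H) {t : ℝ} (ht : 0 ≤ t)
    (hlog : (∫ s in 0..t, ‖H s‖) < Real.log 2) :
    ∃ Ω : A, HasLog (dyson H t) Ω ∧ NormedSpace.exp Ω = dyson H t ∧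
      (Summable fun n : ℕ => ‖dysonAct H (bchElement (n + 1)) t‖) ∧
      HasSum (fun n : ℕ => dysonAct H (bchElement (n + 1)) t) Ω := by
  set f : PowerSeries A := PowerSeries.mk fun n => dysonTerm H n t with hf
  have hcoeff : ∀ n, PowerSeries.coeff (n + 1) (f - 1) = dysonTerm H (n + 1) t := fun n => by
    rw [coeff_dyson_sub_one, if_neg n.succ_ne_zero]
  have hcoeff0 : PowerSeries.coeff 0 (f - 1) = 0 := by
    rw [coeff_dyson_sub_one, if_pos rfl]
  have hX := summable_norm_dysonTerm hH ht
  have hg : Summable fun n => ‖PowerSeries.coeff n (f - 1)‖ := by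
    rw [← summable_nat_add_iff 1]
    simp only [hcoeff]
    exact (summable_nat_add_iff 1).2 hX
  have hexp : Real.exp (∫ s in 0..t, ‖H s‖) - 1 < 1 := by
    have := (Real.lt_log_iff_exp_lt two_pos).1 hlog
    linarith
  have hlt : ∑' n, ‖PowerSeries.coeff n (f - 1)‖ < 1 := by
    rw [hg.tsum_eq_zero_add, hcoeff0, norm_zero, zero_add]
    simp only [hcoeff]
    refine lt_of_le_of_lt ?_ hexp
    rw [← (hasSum_pow_succ_div_factorial _).tsum_eq]
    exact ((summable_nat_add_iff 1).2 hX).tsum_le_tsum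
      (fun n => norm_dysonTerm_succ_le hH n ht) (hasSum_pow_succ_div_factorial _).summable
  have hsum : 1 + ∑' n, PowerSeries.coeff n (f - 1) = dyson H t := by
    rw [hg.of_norm.tsum_eq_zero_add, hcoeff0, zero_add, dyson, hX.of_norm.tsum_eq_zero_add,
      dysonTerm_zero]
    simp only [hcoeff]
  obtain ⟨Ω, h1, h2, h3⟩ := exists_hasSum_log_coeff hg hlt
    (fun n => PowerSeries.coeff n (formalLog f)) fun n => by
      rw [coeff_formalLog_eq_sum_range]
      -- In degree `n` only finitely many powers contribute, as `(f - 1)^(k+1)` has order at least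
      -- `k + 1`.
      refine hasSum_sum_of_ne_finset_zero fun k hk => ?_
      rw [coeff_pow_eq_zero_of_lt hcoeff0 (by simpa [Nat.lt_succ_iff] using hk), smul_zero]
  have hact : ∀ n, dysonAct H (bchElement (n + 1)) t =
      PowerSeries.coeff (n + 1) (formalLog f) := fun n =>
    (coeff_formalLog_dyson hH t n.succ_pos).symm
  rw [hsum] at h1
  refine ⟨Ω, h1, exp_eq_of_hasLog ?_ h1, ?_, ?_⟩
  · rw [← hsum, add_sub_cancel_left]
    exact (norm_tsum_le_tsum_norm hg).trans_lt hlt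
  · simp only [hact]
    exact (summable_nat_add_iff (f := fun n => ‖PowerSeries.coeff n (formalLog f)‖) 1).2 h2
  · simp only [hact]
    have h5 := (hasSum_nat_add_iff' (f := fun n => PowerSeries.coeff n (formalLog f)) 1).2 h3
    rwa [Finset.sum_range_one, coeff_zero_formalLog, sub_zero] at h5

end Analytic

/-! ### Dependence on the values at non-negative times -/

section Congr

variable {A : Type*} [NormedRing A] [NormedAlgebra ℝ A]

theorem pairing_congr {H K : ℝ → A} (h : EqOn H K (Ici 0)) {n : ℕ} {P : Set (Fin n → ℝ)}
    (hP : MeasurableSet P) (hP0 : ∀ u ∈ P, ∀ i, 0 ≤ u i) : pairing P H = pairing P K :=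
  setIntegral_congr_fun hP fun u hu => by
    simp only [h (hP0 u hu _)]

theorem dysonTerm_congr {H K : ℝ → A} (h : EqOn H K (Ici 0)) : dysonTerm H = dysonTerm K := by
  ext n t
  exact pairing_congr h (isCompact_simplex n t).measurableSet fun u hu i => (hu.2 i).1

theorem dyson_congr {H K : ℝ → A} (h : EqOn H K (Ici 0)) : dyson H = dyson K := by
  ext t
  rw [dyson, dyson, dysonTerm_congr h]

theorem dysonAct_congr {H K : ℝ → A} (h : EqOn H K (Ici 0)) {n : ℕ} (μ : PermSpace n) (t : ℝ) :
    dysonAct H μ t = dysonAct K μ t := by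
  refine Finset.sum_congr rfl fun σ _ => ?_
  rw [pairing_congr h (isCompact_permSimplex σ t).measurableSet]
  rintro _ ⟨u, hu, rfl⟩ i
  exact (hu.2 _).1

end Congr

end ContinuousBCH

end

open ContinuousBCH in
/-- Continuous Baker–Campbell–Hausdorff formula. -/
theorem mainTheorem1 {A : Type*} [NormedRing A] [NormedAlgebra ℝ A] [CompleteSpace A]
    (H : ℝ → A) (hH : ContinuousOn H (Set.Ici 0)) :
    -- the Dyson series converges absolutely and solves `X' = X H`, `X(0) = 1`
    ((∀ t : ℝ, 0 ≤ t → Summable fun n => ‖dysonTerm H n t‖) ∧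
      dyson H 0 = 1 ∧
      ∀ t : ℝ, 0 ≤ t →
        HasDerivWithinAt (dyson H) (dyson H t * H t) (Set.Ici 0) t) ∧
    -- the coefficients lie in the descent algebra, and the two expressions for them agree
    (∀ n : ℕ, 1 ≤ n →
      MemDescentAlgebra n (bchElement n) ∧ bchElement n = bchElementEq n) ∧
    -- the formula as an identity of formal series, graded by the number of factors `H`
    (∀ t : ℝ, 0 ≤ t →
      PowerSeries.coeff 0 (PowerSeries.mk fun n => dysonTerm H n t) = 1 ∧
      PowerSeries.coeff 0 (formalLog (PowerSeries.mk fun n => dysonTerm H n t)) = 0 ∧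
      ∀ n : ℕ, 1 ≤ n →
        PowerSeries.coeff n (formalLog (PowerSeries.mk fun n => dysonTerm H n t)) =
            dysonAct H (bchElement n) t ∧
        PowerSeries.coeff n (formalLog (PowerSeries.mk fun n => dysonTerm H n t)) =
            dysonAct H (bchElementEq n) t) ∧
    -- the formula as an identity of convergent series
    (∀ t : ℝ, 0 ≤ t → (∫ s in (0 : ℝ)..t, ‖H s‖) < Real.log 2 →
      ∃ Ω : A, HasLog (dyson H t) Ω ∧ NormedSpace.exp Ω = dyson H t ∧
        (Summable fun n : ℕ => ‖dysonAct H (bchElement (n + 1)) t‖) ∧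
        HasSum (fun n : ℕ => dysonAct H (bchElement (n + 1)) t) Ω ∧
        HasSum (fun n : ℕ => dysonAct H (bchElementEq (n + 1)) t) Ω) := by
  -- Extending `H` by its value at `0` to negative times gives a function continuous on `ℝ`; the
  -- integrals only see non-negative times.
  obtain ⟨K, hK, hHK⟩ : ∃ K : ℝ → A, Continuous K ∧ Set.EqOn H K (Set.Ici 0) :=
    ⟨fun s => H (max 0 s), hH.comp_continuous (by fun_prop) fun s => le_max_left 0 s,
      fun s hs => by simp only [max_eq_right (Set.mem_Ici.1 hs)]⟩
  simp only [dysonTerm_congr hHK, dyson_congr hHK, dysonAct_congr hHK]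
  refine ⟨⟨fun t ht => summable_norm_dysonTerm hK ht, dyson_zero hK, fun t ht => ?_⟩,
    fun n hn => ⟨memDescentAlgebra_bchElement n, bchElement_eq_bchElementEq hn⟩,
    fun t ht => ⟨?_, coeff_zero_formalLog _, fun n hn => ?_⟩, fun t ht hlog => ?_⟩
  · rw [hHK ht]
    exact hasDerivWithinAt_dyson hK ht
  · rw [PowerSeries.coeff_mk, dysonTerm_zero]
  · rw [← bchElement_eq_bchElementEq hn]
    exact ⟨coeff_formalLog_dyson hK t hn, coeff_formalLog_dyson hK t hn⟩
  · have hint : (∫ s in (0 : ℝ)..t, ‖H s‖) = ∫ s in (0 : ℝ)..t, ‖K s‖ :=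
      intervalIntegral.integral_congr fun s hs => by
        rw [Set.uIcc_of_le ht] at hs
        simp only [hHK (Set.mem_Ici.2 hs.1)]
    obtain ⟨Ω, h1, h2, h3, h4⟩ := exists_log_dyson hK ht (hint ▸ hlog)
    refine ⟨Ω, h1, h2, h3, h4, ?_⟩
    simpa only [← bchElement_eq_bchElementEq (Nat.succ_pos _)] using h4
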